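/- All groups are finite. For a group $G$ let $c(G)$ be the number of cyclic subgroups of $G$ and let $\alpha(G) = c(G)/|G|$. Let $C_2$ be the group of order $2$, $S_3$ the symmetric group on three letters and $D_8$ the dihedral group of order $8$. Then $\alpha(S_3)=5/6$, $\alpha(D_8)=7/8$, and for every $n \geq 0$ one has $\alpha(C_2^n \times S_3) = 5/6$, $\alpha(C_2^n \times D_8) = 7/8$ and $\alpha(C_2^n)=1$. If $\alpha(G) \geq 5/6$, then one of the following holds: (1) $G \cong C_2^n \times S_3$ for some $n \geq 0$, and $\alpha(G)=5/6$; (2) $G \cong C_2^n \times D_8$ for some $n \geq 0$, and $\alpha(G)=7/8$; (3) $G \cong C_2^n$ for some $n \geq 0$, and $\alpha(G)=1$. Consequently, the maximum of $\alpha$ over the family of non-abelian groups is $7/8$, and the non-abelian groups attaining it are exactly the groups isomorphic to $C_2^n \times D_8$ for some $n \geq 0$; and the maximum of $\alpha$ over the family of non-nilpotent groups is $5/6$, and the non-nilpotent groups attaining it are exactly the groups isomorphic to $C_2^n \times S_3$ for some $n \geq 0$. -/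

import Mathlib

universe u

/-- The number `c(G)` of cyclic subgroups of `G`. -/
noncomputable def numCyclicSubgroups (G : Type*) [Group G] : ℕ :=
  Set.ncard {H : Subgroup G | IsCyclic H}

/-- `α(G) = c(G) / |G|`. -/
noncomputable def alpha (G : Type*) [Group G] : ℚ :=
  (numCyclicSubgroups G : ℚ) / (Nat.card G : ℚ)

/-- The elementary abelian `2`-group `C₂ⁿ`. -/
abbrev C2pow (n : ℕ) : Type := Fin n → Multiplicative (ZMod 2)

/-- The symmetric group `S₃`. -/
abbrev S3 : Type := Equiv.Perm (Fin 3)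

/-- The dihedral group `D₈` of order `8`. -/
abbrev D8 : Type := DihedralGroup 4

/-- The family of finite non-abelian groups. -/
def nonAbelianGroups : Set FiniteGrp.{u} := {G | ¬ ∀ x y : G, x * y = y * x}

/-- The family of finite non-nilpotent groups. -/
def nonNilpotentGroups : Set FiniteGrp.{u} := {G | ¬ Group.IsNilpotent G}

/-- `a` is the maximum `α_𝓕 = max {α(G) : G ∈ 𝓕}`. -/
def IsMaxAlpha (F : Set FiniteGrp.{u}) (a : ℚ) : Prop :=
  IsGreatest {q : ℚ | ∃ G ∈ F, alpha G = q} a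

/-- The family `m𝓕` of the groups in `𝓕` at which the maximum of `α` on `𝓕` is attained. -/
def maximizers (F : Set FiniteGrp.{u}) : Set FiniteGrp.{u} :=
  {G | G ∈ F ∧ IsMaxAlpha F (alpha G)}

/-! Write I for the solutions of x² = 1. A cyclic subgroup of order n has φ(n) generators, and φ(n)
≥ 2 unless n ≤ 2, so 2c(G) ≤ |G| + |I|, with equality when all element orders divide 4 or 6.
Equality gives the listed values of α, and α(G) ≥ 5/6 forces |I| ≥ 2|G|/3
(`two_mul_card_le_of_alpha`).

For g in I, elements of I ∩ gI commute with g, so |C(g)| ≥ 2|I| - |G| ≥ |G|/3 and C(g) has index at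
most 3. If all of I is central, G is abelian, hence elementary abelian. If some index is 3, then
C(g) ⊆ I, and g with a non-commuting conjugate generates a copy of S₃
(`exists_mulEquiv_C2pow_prod_S3`). Otherwise some index is 2, C(g) is again elementary abelian, and
g with an involution outside C(g) generates a copy of D₈ (`exists_mulEquiv_C2pow_prod_D8`). In both
cases an elementary abelian group centralizing the dihedral group is a direct complement. The maxima
then follow by testing the three families for commutativity and nilpotency. -/

/-- The set of solutions of `x ^ 2 = 1` in `G`. -/
def sqOne (G : Type*) [Group G] : Set G := {x | x * x = 1}

lemma mem_sqOne {G : Type*} [Group G] {x : G} : x ∈ sqOne G ↔ x * x = 1 := Iff.rfl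

lemma mem_sqOne_iff_inv {G : Type*} [Group G] {x : G} : x ∈ sqOne G ↔ x⁻¹ = x := by
  rw [mem_sqOne, mul_eq_one_iff_inv_eq]

/-! ### Cyclic subgroups versus solutions of x² = 1 -/

section Counting

variable {G : Type*} [Group G]

open Classical in
/-- Both `2 c(G)` and `|G| + |{x | x ^ 2 = 1}|` are sums over the cyclic subgroups of `G`. -/
lemma sums_over_cyclic [Fintype G] :
    (2 * numCyclicSubgroups G = ∑ _H ∈ Finset.univ.image (Subgroup.zpowers : G → Subgroup G), 2) ∧
    Nat.card G + (sqOne G).ncard =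
      ∑ H ∈ Finset.univ.image (Subgroup.zpowers : G → Subgroup G),
        ((Finset.univ.filter fun x : G => Subgroup.zpowers x = H).card +
          (Finset.univ.filter fun x : G => x ∈ sqOne G ∧ Subgroup.zpowers x = H).card) := by
  constructor
  · have h : {H : Subgroup G | IsCyclic H} =
        ((Finset.univ.image (Subgroup.zpowers : G → Subgroup G) : Finset (Subgroup G)) :
          Set (Subgroup G)) := by
      ext H
      simp [Subgroup.isCyclic_iff_exists_zpowers_eq_top]
    rw [numCyclicSubgroups, h, Set.ncard_coe_finset, Finset.sum_const, smul_eq_mul, mul_comm]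
  · rw [Finset.sum_add_distrib]
    congr 1
    · rw [Nat.card_eq_fintype_card, ← Finset.card_univ]
      exact Finset.card_eq_sum_card_image _ _
    · have h : sqOne G = ((Finset.univ.filter fun x : G => x ∈ sqOne G : Finset G) : Set G) := by
        ext; simp
      rw [h, Set.ncard_coe_finset, ← h]
      rw [Finset.card_eq_sum_card_fiberwise (f := Subgroup.zpowers)
        (t := Finset.univ.image (Subgroup.zpowers : G → Subgroup G)) (by intro x _; simp)]
      simp only [Finset.filter_filter]

variable [Finite G]

/-- Each cyclic subgroup contributes at least 2 to |G| + |I|: a generator x in I is counted in both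
terms, and otherwise x and x⁻¹ are distinct generators. -/
lemma two_mul_numCyclicSubgroups_le :
    2 * numCyclicSubgroups G ≤ Nat.card G + (sqOne G).ncard := by
  classical
  have := Fintype.ofFinite G
  rw [sums_over_cyclic.1, sums_over_cyclic.2]
  refine Finset.sum_le_sum fun H hH => ?_
  obtain ⟨x, -, rfl⟩ := Finset.mem_image.1 hH
  by_cases hx : x ∈ sqOne G
  · have h1 : 0 < (Finset.univ.filter fun y : G =>
        Subgroup.zpowers y = Subgroup.zpowers x).card := Finset.card_pos.2 ⟨x, by simp⟩
    have h2 : 0 < (Finset.univ.filter fun y : G => y ∈ sqOne G ∧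
        Subgroup.zpowers y = Subgroup.zpowers x).card := Finset.card_pos.2 ⟨x, by simp [hx]⟩
    omega
  · refine le_add_right ?_
    rw [← Finset.card_pair (fun h => hx (mem_sqOne_iff_inv.2 h.symm) : x ≠ x⁻¹)]
    exact Finset.card_le_card (by intro y; simp; rintro (rfl | rfl) <;> simp)

/-- If a cyclic subgroup only has the generators `x` and `x⁻¹`, the bound is an equality. -/
lemma two_mul_numCyclicSubgroups_eq
    (h : ∀ x y : G, Subgroup.zpowers y = Subgroup.zpowers x → y = x ∨ y = x⁻¹) :
    2 * numCyclicSubgroups G = Nat.card G + (sqOne G).ncard := by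
  classical
  have := Fintype.ofFinite G
  refine le_antisymm two_mul_numCyclicSubgroups_le ?_
  rw [sums_over_cyclic.1, sums_over_cyclic.2]
  refine Finset.sum_le_sum fun H hH => ?_
  obtain ⟨x, -, rfl⟩ := Finset.mem_image.1 hH
  by_cases hx : x ∈ sqOne G
  · have key : ∀ y, Subgroup.zpowers y = Subgroup.zpowers x → y = x := fun y hy => by
      rcases h x y hy with h | h
      · exact h
      · rw [h, mem_sqOne_iff_inv.1 hx]
    have h1 : (Finset.univ.filter fun y : G => Subgroup.zpowers y = Subgroup.zpowers x).card ≤ 1 :=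
      Finset.card_le_one_iff_subset_singleton.2 ⟨x, by intro y; simpa using key y⟩
    have h2 : (Finset.univ.filter fun y : G => y ∈ sqOne G ∧
        Subgroup.zpowers y = Subgroup.zpowers x).card ≤ 1 :=
      Finset.card_le_one_iff_subset_singleton.2 ⟨x, by intro y; simpa using fun _ => key y⟩
    omega
  · have h2 : (Finset.univ.filter fun y : G => y ∈ sqOne G ∧
        Subgroup.zpowers y = Subgroup.zpowers x) = ∅ := by
      refine Finset.filter_eq_empty_iff.2 fun y _ hy => hx ?_
      rcases h x y hy.2 with h | h
      · exact h ▸ hy.1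
      · have := hy.1
        rw [mem_sqOne_iff_inv, h, inv_inv] at this
        exact mem_sqOne_iff_inv.2 this.symm
    rw [h2, Finset.card_empty, add_zero]
    calc _ ≤ ({x, x⁻¹} : Finset G).card :=
          Finset.card_le_card (by intro y; simpa using h x y)
      _ ≤ 2 := Finset.card_le_two

omit [Finite G] in
-- φ(n) ≤ 2 for n dividing 4 or 6: the exponents coprime to n are ±1 only.
lemma eq_or_eq_inv_of_zpowers_eq (hG : ∀ x : G, x ^ 4 = 1 ∨ x ^ 6 = 1) (x y : G)
    (h : Subgroup.zpowers y = Subgroup.zpowers x) : y = x ∨ y = x⁻¹ := by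
  classical
  have hx0 : IsOfFinOrder x := by
    rcases hG x with h | h <;> exact isOfFinOrder_iff_pow_eq_one.2 ⟨_, by norm_num, h⟩
  have hy : y ∈ Subgroup.zpowers x := h ▸ Subgroup.mem_zpowers y
  obtain ⟨k, hk, rfl⟩ := (hx0.mem_zpowers_iff_mem_range_orderOf).1 hy |> Finset.mem_image.1
  have ho : orderOf (x ^ k) = orderOf x := by
    rw [← Nat.card_zpowers, h, Nat.card_zpowers]
  rw [Finset.mem_range] at hk
  have hc : (orderOf x).Coprime k := by
    rw [hx0.orderOf_pow] at ho
    have := (Nat.div_eq_self.1 ho).resolve_left hx0.orderOf_pos.ne'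
    exact this
  have hle : orderOf x ∣ 4 ∨ orderOf x ∣ 6 := by
    simpa [orderOf_dvd_iff_pow_eq_one] using hG x
  have hp := pow_orderOf_eq_one x
  have key : k = 1 ∨ k + 1 = orderOf x ∨ x = 1 := by
    have hn : orderOf x ≤ 6 := by
      rcases hle with h | h
      · exact (Nat.le_of_dvd (by norm_num) h).trans (by norm_num)
      · exact Nat.le_of_dvd (by norm_num) h
    rw [← orderOf_eq_one_iff]
    generalize orderOf x = n at *
    interval_cases n <;> interval_cases k <;> simp_all (config := {decide := true})
  rcases key with rfl | hk | rfl
  · simp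
  · right
    rw [eq_inv_iff_mul_eq_one, ← pow_succ, hk, hp]
  · simp

/-- `|{x ∈ G × H | x ^ 2 = 1}|` is multiplicative. -/
lemma ncard_sqOne_prod (H K : Type*) [Group H] [Group K] :
    (sqOne (H × K)).ncard = (sqOne H).ncard * (sqOne K).ncard := by
  rw [← Set.ncard_prod]
  congr 1
  ext ⟨a, b⟩
  simp [sqOne]

lemma ncard_sqOne_eq_card {H : Type*} [Group H] (h : ∀ x : H, x * x = 1) :
    (sqOne H).ncard = Nat.card H := by
  rw [← Set.ncard_univ]
  congr 1
  ext x
  simp [sqOne, h]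

lemma alpha_eq_of_pow (hG : ∀ x : G, x ^ 4 = 1 ∨ x ^ 6 = 1) :
    alpha G = (1 + (sqOne G).ncard / Nat.card G) / 2 := by
  have h := two_mul_numCyclicSubgroups_eq (eq_or_eq_inv_of_zpowers_eq hG)
  have h0 : (Nat.card G : ℚ) ≠ 0 := by exact_mod_cast Nat.card_pos.ne'
  have h' : (2 * numCyclicSubgroups G : ℚ) = Nat.card G + (sqOne G).ncard := by exact_mod_cast h
  rw [alpha]
  field_simp
  linarith

lemma two_mul_card_le_of_alpha (h : alpha G ≥ 5 / 6) :
    2 * Nat.card G ≤ 3 * (sqOne G).ncard := by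
  have h1 : (2 * numCyclicSubgroups G : ℚ) ≤ Nat.card G + (sqOne G).ncard := by
    exact_mod_cast two_mul_numCyclicSubgroups_le (G := G)
  have h0 : (0 : ℚ) < Nat.card G := by exact_mod_cast Nat.card_pos
  rw [alpha, ge_iff_le, le_div_iff₀ h0] at h
  have : (2 * Nat.card G : ℚ) ≤ 3 * (sqOne G).ncard := by linarith
  exact_mod_cast this

end Counting

/-! ### Isomorphism invariance and the values of α -/

lemma numCyclicSubgroups_congr {G H : Type*} [Group G] [Group H] (e : G ≃* H) :
    numCyclicSubgroups G = numCyclicSubgroups H := by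
  refine Set.ncard_congr (fun K _ => K.map e.toMonoidHom) (fun K hK => ?_) (fun K L _ _ h => ?_)
    (fun K hK => ⟨K.comap e.toMonoidHom, ?_, ?_⟩)
  · have : IsCyclic K := hK
    exact (e.subgroupMap K).isCyclic.1 this
  · exact Subgroup.map_injective e.injective h
  · have : IsCyclic K := hK
    refine ((e.subgroupMap (K.comap e.toMonoidHom)).isCyclic).2 ?_
    have h : (K.comap e.toMonoidHom).map e.toMonoidHom = K :=
      Subgroup.map_comap_eq_self_of_surjective e.surjective _
    change IsCyclic ((K.comap e.toMonoidHom).map e.toMonoidHom)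
    rwa [h]
  · exact Subgroup.map_comap_eq_self_of_surjective e.surjective _

lemma alpha_congr {G H : Type*} [Group G] [Group H] (e : G ≃* H) : alpha G = alpha H := by
  rw [alpha, alpha, numCyclicSubgroups_congr e, Nat.card_congr e.toEquiv]

lemma mul_self_C2pow (n : ℕ) (x : C2pow n) : x * x = 1 := by
  funext i
  exact (by decide : ∀ y : Multiplicative (ZMod 2), y * y = 1) (x i)

/-- `α(C₂ⁿ × H)` for `H` of exponent dividing `4` or `6`. -/
lemma alpha_C2pow_prod {H : Type*} [Group H] [Finite H]
    (hH : (∀ x : H, x ^ 4 = 1) ∨ ∀ x : H, x ^ 6 = 1) (n : ℕ) :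
    alpha (C2pow n × H) = (1 + (sqOne H).ncard / Nat.card H) / 2 := by
  rw [alpha_eq_of_pow, ncard_sqOne_prod, Nat.card_prod, ncard_sqOne_eq_card (mul_self_C2pow n)]
  · have h0 : (Nat.card (C2pow n) : ℚ) ≠ 0 := by exact_mod_cast Nat.card_pos.ne'
    push_cast
    rw [mul_div_mul_left _ _ h0]
  · have h2 : ∀ (x : C2pow n) (k : ℕ), x ^ (2 * k) = 1 := fun x k => by
      rw [pow_mul, pow_two, mul_self_C2pow, one_pow]
    rintro ⟨x, y⟩
    rcases hH with h | h
    · exact Or.inl (Prod.ext (h2 x 2) (h y))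
    · exact Or.inr (Prod.ext (h2 x 3) (h y))

lemma alpha_C2pow_prod_S3 (n : ℕ) : alpha (C2pow n × S3) = 5 / 6 := by
  have h : (sqOne S3).ncard = 4 := by
    have : sqOne S3 = ((Finset.univ.filter fun x : S3 => x * x = 1 : Finset S3) : Set S3) := by
      ext; simp [sqOne]
    rw [this, Set.ncard_coe_finset]
    decide
  have h6 : ∀ x : S3, x ^ 6 = 1 := fun x => by
    have := pow_card_eq_one' (x := x)
    rwa [Nat.card_eq_fintype_card, Fintype.card_perm] at this
  rw [alpha_C2pow_prod (Or.inr h6), h, Nat.card_eq_fintype_card, Fintype.card_perm]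
  norm_num [Nat.factorial]

lemma alpha_C2pow_prod_D8 (n : ℕ) : alpha (C2pow n × D8) = 7 / 8 := by
  have h : (sqOne D8).ncard = 6 := by
    have : sqOne D8 = ((Finset.univ.filter fun x : D8 => x * x = 1 : Finset D8) : Set D8) := by
      ext; simp [sqOne]
    rw [this, Set.ncard_coe_finset]
    decide
  rw [alpha_C2pow_prod (Or.inl (by decide)), h, DihedralGroup.nat_card]
  norm_num

lemma alpha_C2pow (n : ℕ) : alpha (C2pow n) = 1 := by
  have h0 : (Nat.card (C2pow n) : ℚ) ≠ 0 := by exact_mod_cast Nat.card_pos.ne'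
  rw [alpha_eq_of_pow, ncard_sqOne_eq_card (mul_self_C2pow n), div_self h0]
  · norm_num
  · intro x
    left
    rw [show 4 = 2 * 2 from rfl, pow_mul, pow_two, mul_self_C2pow]

/-- A factor `C₂⁰` may be dropped. -/
def C2powZeroProd (H : Type*) [Group H] : C2pow 0 × H ≃* H where
  toFun x := x.2
  invFun y := (1, y)
  left_inv _ := Prod.ext (Subsingleton.elim _ _) rfl
  right_inv _ := rfl
  map_mul' _ _ := rfl

/-! ### Centralizers of involutions when I is large -/

section Cardinalities

variable {G : Type*} [Group G] [Finite G]

lemma Subgroup.eq_top_of_card_lt_two_mul {H : Subgroup G} (h : Nat.card G < 2 * Nat.card H) :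
    H = ⊤ := by
  rw [← Subgroup.index_eq_one]
  have h1 := H.card_mul_index
  have h2 : H.index ≠ 0 := Subgroup.FiniteIndex.index_ne_zero
  by_contra h3
  have : 2 ≤ H.index := by omega
  nlinarith

lemma ncard_le_card_of_subset {S : Set G} {H : Subgroup G} (h : S ⊆ H) :
    S.ncard ≤ Nat.card H :=
  Set.ncard_le_ncard h

lemma Subgroup.eq_top_of_sqOne_subset {H : Subgroup G} (h : sqOne G ⊆ H)
    (hi : Nat.card G < 2 * (sqOne G).ncard) : H = ⊤ :=
  Subgroup.eq_top_of_card_lt_two_mul (hi.trans_le (by have := ncard_le_card_of_subset h; omega))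

/-- H is covered by N and g⁻¹N. -/
lemma card_le_two_mul_card {H N : Subgroup G} {g : G} (h : ∀ a ∈ H, a ∈ N ∨ g * a ∈ N) :
    Nat.card H ≤ 2 * Nat.card N := by
  have hs : (H : Set G) ⊆ N ∪ (fun x => g⁻¹ * x) '' N := fun a ha => by
    rcases h a ha with h | h
    · exact Or.inl h
    · exact Or.inr ⟨g * a, h, by simp⟩
  have h1 := (Set.ncard_le_ncard hs).trans (Set.ncard_union_le _ _)
  have h2 := Set.ncard_image_le (s := (N : Set G)) (f := fun x => g⁻¹ * x)
  have h3 : (H : Set G).ncard = Nat.card H := rfl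
  have h4 : (N : Set G).ncard = Nat.card N := rfl
  omega

omit [Finite G] in
lemma mem_centralizer_of_sqOne {g x : G} (hg : g ∈ sqOne G) (hx : x ∈ sqOne G)
    (h : g * x ∈ sqOne G) : x ∈ Subgroup.centralizer {g} := by
  rw [mem_sqOne_iff_inv] at *
  rw [Subgroup.mem_centralizer_singleton_iff]
  rw [mul_inv_rev, hg, hx] at h
  exact h

/-- Inclusion-exclusion for `I` and `gI`, where `I = {x | x ^ 2 = 1}`. -/
lemma two_mul_ncard_sqOne_le {g : G} (hg : g ∈ sqOne G) :
    2 * (sqOne G).ncard ≤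
      Nat.card G + (sqOne G ∩ Subgroup.centralizer {g} : Set G).ncard := by
  have h1 := Set.ncard_union_add_ncard_inter (sqOne G) ((fun x => g * x) '' sqOne G)
  rw [Set.ncard_image_of_injective _ (mul_right_injective g)] at h1
  have h2 := Set.ncard_le_card (sqOne G ∪ (fun x => g * x) '' sqOne G)
  have h3 : (sqOne G ∩ (fun x => g * x) '' sqOne G : Set G).ncard ≤
      (sqOne G ∩ Subgroup.centralizer {g} : Set G).ncard := by
    refine Set.ncard_le_ncard ?_
    rintro x ⟨hx, y, hy, rfl⟩
    refine ⟨hx, mem_centralizer_of_sqOne hg hx ?_⟩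
    have : g * (g * y) = y := by rw [← mul_assoc, mem_sqOne.1 hg, one_mul]
    rwa [this]
  omega

/-- With S = I \ C(g), the sets S, gS and C(g) are pairwise disjoint. -/
lemma two_mul_ncard_sqOne_diff_le {g : G} (hg : g ∈ sqOne G) :
    2 * (sqOne G \ Subgroup.centralizer {g} : Set G).ncard + Nat.card (Subgroup.centralizer {g}) ≤
      Nat.card G := by
  set C := Subgroup.centralizer {g} with hC
  have hgC : g ∈ C := Subgroup.mem_centralizer_singleton_iff.2 rfl
  set S : Set G := sqOne G \ C with hS
  have hd : Disjoint S ((fun x => g * x) '' S) := by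
    rw [Set.disjoint_left]
    rintro _ h ⟨y, hy, rfl⟩
    exact hy.2 (mem_centralizer_of_sqOne hg hy.1 h.1)
  have hd' : Disjoint (S ∪ (fun x => g * x) '' S) C := by
    rw [Set.disjoint_left]
    rintro x (h | ⟨y, hy, rfl⟩) hx
    · exact h.2 hx
    · exact hy.2 ((C.mul_mem_cancel_left hgC).1 hx)
  have h1 := Set.ncard_union_eq hd
  rw [Set.ncard_image_of_injective _ (mul_right_injective g)] at h1
  have h2 := Set.ncard_union_eq hd'
  have h3 := Set.ncard_le_card ((S ∪ (fun x => g * x) '' S) ∪ C)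
  have h4 : (C : Set G).ncard = Nat.card C := rfl
  omega

omit [Finite G] in
lemma ncard_sqOne_subgroup (H : Subgroup G) : (sqOne H).ncard = (sqOne G ∩ H : Set G).ncard := by
  rw [← Set.ncard_image_of_injective _ H.subtype_injective]
  congr 1
  ext x
  constructor
  · rintro ⟨y, hy, rfl⟩
    exact ⟨congrArg Subtype.val hy, y.2⟩
  · rintro ⟨hx, hH⟩
    exact ⟨⟨x, hH⟩, Subtype.ext hx, rfl⟩

/-- In an abelian group I is a subgroup, and no proper subgroup has more than half of the elements.
-/
lemma mul_self_of_commute (hcomm : ∀ x y : G, x * y = y * x)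
    (hi : Nat.card G < 2 * (sqOne G).ncard) (x : G) : x * x = 1 := by
  let K : Subgroup G :=
    { carrier := sqOne G
      one_mem' := mul_one 1
      mul_mem' := fun {a b} ha hb => by
        rw [mem_sqOne] at *
        rw [mul_assoc, hcomm a b, ← mul_assoc b, hb, one_mul, ha]
      inv_mem' := fun {a} ha => by rwa [mem_sqOne_iff_inv.1 ha] }
  have hK : K = ⊤ := Subgroup.eq_top_of_sqOne_subset (fun x hx => hx) hi
  exact (hK ▸ Subgroup.mem_top x : x ∈ K)

/-- If more than three quarters of the elements satisfy `x ^ 2 = 1`, then all do. -/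
lemma mul_self_of_three_mul_card_lt (hi : 3 * Nat.card G < 4 * (sqOne G).ncard) (x : G) :
    x * x = 1 := by
  have hZ : Subgroup.center G = ⊤ := by
    refine Subgroup.eq_top_of_sqOne_subset (fun g hg => ?_) (by omega)
    -- Here |C(g)| ≥ 2|I| - |G| > |G|/2.
    have hC : Subgroup.centralizer {g} = ⊤ := by
      refine Subgroup.eq_top_of_card_lt_two_mul ?_
      have h1 := two_mul_ncard_sqOne_le hg
      have h2 := ncard_le_card_of_subset
        (S := sqOne G ∩ Subgroup.centralizer {g}) (H := Subgroup.centralizer {g})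
        Set.inter_subset_right
      omega
    refine Subgroup.mem_center_iff.2 fun y => ?_
    exact Subgroup.mem_centralizer_singleton_iff.1 (hC ▸ Subgroup.mem_top y)
  refine mul_self_of_commute (fun x y => ?_) (by omega) x
  exact Subgroup.mem_center_iff.1 (hZ ▸ Subgroup.mem_top y) x

omit [Finite G] in
/-- Among four conjugates of `g` two agree if the centralizer of `g` has index at most three. -/
lemma exists_conj_eq {g : G} (h0 : (Subgroup.centralizer {g}).index ≠ 0)
    (h3 : (Subgroup.centralizer {g}).index ≤ 3) (f : Fin 4 → G) :
    ∃ i j, i < j ∧ f i * g * (f i)⁻¹ = f j * g * (f j)⁻¹ := by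
  have : Finite (G ⧸ Subgroup.centralizer {g}) := Nat.finite_of_card_ne_zero h0
  have := Fintype.ofFinite (G ⧸ Subgroup.centralizer {g})
  have key : ∀ i j, (f i : G ⧸ Subgroup.centralizer {g}) = f j →
      f i * g * (f i)⁻¹ = f j * g * (f j)⁻¹ := by
    intro i j h
    rw [QuotientGroup.eq, Subgroup.mem_centralizer_singleton_iff] at h
    calc f i * g * (f i)⁻¹ = f i * (g * ((f i)⁻¹ * f j)) * (f j)⁻¹ := by group
      _ = f j * g * (f j)⁻¹ := by rw [← h]; group
  obtain ⟨i, j, hij, h⟩ := Fintype.exists_ne_map_eq_of_card_lt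
    (fun i => (f i : G ⧸ Subgroup.centralizer {g})) (by
      rw [← Nat.card_eq_fintype_card (α := G ⧸ _), Fintype.card_fin]
      exact Nat.lt_succ_of_le h3)
  rcases lt_or_gt_of_ne hij with hlt | hlt
  · exact ⟨i, j, hlt, key i j h⟩
  · exact ⟨j, i, hlt, (key i j h).symm⟩

end Cardinalities

/-! ### Elementary abelian groups, dihedral groups and their products -/

section Structure

/-- A finite group of exponent dividing `2` is a power of `C₂`. -/
lemma exists_mulEquiv_C2pow (G : Type*) [Group G] [Finite G] (h : ∀ x : G, x * x = 1) :
    ∃ n : ℕ, Nonempty (G ≃* C2pow n) := by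
  let _ : CommGroup G :=
    { ‹Group G› with
      mul_comm := fun a b => by
        have hi : ∀ x : G, x⁻¹ = x := fun x => inv_eq_of_mul_eq_one_left (h x)
        rw [← hi (a * b), mul_inv_rev, hi, hi] }
  let _ : Module (ZMod 2) (Additive G) :=
    AddCommGroup.zmodModule (fun x => by rw [two_nsmul]; exact h x)
  let b := Module.finBasis (ZMod 2) (Additive G)
  let e := b.equivFun
  refine ⟨Module.finrank (ZMod 2) (Additive G), ⟨{
    toFun := fun x i => Multiplicative.ofAdd (e (Additive.ofMul x) i)
    invFun := fun f => (e.symm fun i => (f i).toAdd).toMul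
    left_inv := fun x => ?_
    right_inv := fun f => ?_
    map_mul' := fun x y => ?_ }⟩⟩
  · exact congrArg Additive.toMul (e.symm_apply_apply (Additive.ofMul x))
  · funext i
    exact congrArg Multiplicative.ofAdd (congrFun (e.apply_symm_apply fun i => (f i).toAdd) i)
  · funext i
    exact congrArg Multiplicative.ofAdd
      (congrFun (e.map_add (Additive.ofMul x) (Additive.ofMul y)) i)

/-- The homomorphism from a dihedral group given by a rotation `t` and a reflection `s`. -/
def dihedralHom {G : Type*} [Group G] {n : ℕ} (t s : G) (ht : t ^ n = 1) (hs : s * s = 1)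
    (hst : s * t * s = t⁻¹) : DihedralGroup n →* G :=
  let p : ZMod n →+ Additive G := ZMod.lift n ⟨zmultiplesHom (Additive G) (Additive.ofMul t), by
    simpa [← ofMul_pow] using congrArg Additive.ofMul ht⟩
  have hp : ∀ i, s * (p i).toMul * s = (p (-i)).toMul := fun i => by
    obtain ⟨k, rfl⟩ := ZMod.intCast_surjective i
    have hinv : s⁻¹ = s := inv_eq_of_mul_eq_one_left hs
    have hk : ∀ k : ℤ, (p (k : ZMod n)).toMul = t ^ k := fun k => by
      simp [p, ← ofMul_zpow]
    have hst' : s * t * s⁻¹ = t⁻¹ := by rw [hinv, hst]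
    rw [← Int.cast_neg, hk, hk, zpow_neg, ← inv_zpow, ← hst', conj_zpow, hinv]
  { toFun := fun d => match d with
      | .r i => (p i).toMul
      | .sr i => s * (p i).toMul
    map_one' := by
      change (p 0).toMul = 1
      simp
    map_mul' := by
      have hss : ∀ x, s * (s * x) = x := fun x => by rw [← mul_assoc, hs, one_mul]
      have hp' : ∀ i, (p i).toMul * s = s * (p (-i)).toMul := fun i => by
        rw [← hp, ← mul_assoc, ← mul_assoc, hs, one_mul]
      rintro (i | i) (j | j)
      · simp
      · simp only [DihedralGroup.r_mul_sr]
        rw [← mul_assoc, hp', mul_assoc, ← toMul_add, ← map_add, sub_eq_neg_add]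
      · simp only [DihedralGroup.sr_mul_r]
        rw [map_add, toMul_add, mul_assoc]
      · simp only [DihedralGroup.sr_mul_sr]
        rw [mul_assoc, ← mul_assoc _ s, hp', mul_assoc, hss, ← toMul_add, ← map_add,
          sub_eq_neg_add] }

lemma dihedralHom_r {G : Type*} [Group G] {n : ℕ} (t s : G) (ht : t ^ n = 1) (hs : s * s = 1)
    (hst : s * t * s = t⁻¹) (k : ℕ) :
    dihedralHom t s ht hs hst (.r (k : ZMod n)) = t ^ k := by
  have : dihedralHom t s ht hs hst (.r 1) = t := by
    change Additive.toMul (ZMod.lift n (A := Additive G) _ (1 : ZMod n)) = t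
    rw [← Int.cast_one, ZMod.lift_coe]
    simp
  rw [← DihedralGroup.r_one_pow, map_pow, this]

lemma dihedralHom_sr {G : Type*} [Group G] {n : ℕ} (t s : G) (ht : t ^ n = 1) (hs : s * s = 1)
    (hst : s * t * s = t⁻¹) (k : ℕ) :
    dihedralHom t s ht hs hst (.sr (k : ZMod n)) = s * t ^ k := by
  rw [← dihedralHom_r t s ht hs hst]
  rfl

/-- A group with commuting subgroups of exponent two and dihedral, meeting trivially, and
of sufficiently large order is a direct product. -/
lemma exists_mulEquiv_C2pow_prod_dihedral {G : Type*} [Group G] [Finite G] {n : ℕ} [NeZero n]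
    (N : Subgroup G) (hN : ∀ x ∈ N, x * x = 1) (t s : G) (ht : t ^ n = 1) (hs : s * s = 1)
    (hst : s * t * s = t⁻¹) (hNt : ∀ x ∈ N, Commute x t) (hNs : ∀ x ∈ N, Commute x s)
    (hr : ∀ k < n, t ^ k ∈ N → k = 0) (hsr : ∀ k < n, s * t ^ k ∉ N)
    (hcard : Nat.card G ≤ Nat.card N * (2 * n)) :
    ∃ m : ℕ, Nonempty (G ≃* C2pow m × DihedralGroup n) := by
  obtain ⟨m, ⟨e⟩⟩ := exists_mulEquiv_C2pow N (fun x => Subtype.ext (hN x x.2))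
  let f := dihedralHom t s ht hs hst
  have hdr : ∀ i : ZMod n, f (.r i) = t ^ i.val := fun i => by
    rw [← dihedralHom_r t s ht hs hst, ZMod.natCast_zmod_val]
  have hdsr : ∀ i : ZMod n, f (.sr i) = s * t ^ i.val := fun i => by
    rw [← dihedralHom_sr t s ht hs hst, ZMod.natCast_zmod_val]
  have hcomm : ∀ (x : N) (d : DihedralGroup n), Commute (N.subtype x) (f d) := by
    rintro x (i | i)
    · rw [hdr]; exact (hNt x x.2).pow_right _
    · rw [hdsr]; exact (hNs x x.2).mul_right ((hNt x x.2).pow_right _)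
  have hf : ∀ d, f d ∈ N → d = 1 := by
    rintro (i | i) h
    · rw [hdr] at h
      rw [(ZMod.val_eq_zero i).1 (hr _ i.val_lt h)]
      rfl
    · rw [hdsr] at h
      exact absurd h (hsr _ i.val_lt)
  let F := N.subtype.noncommCoprod f hcomm
  have hinj : Function.Injective F := by
    rw [injective_iff_map_eq_one]
    rintro ⟨x, d⟩ h
    have h' : (x : G) * f d = 1 := h
    have hd : d = 1 := hf d (by rw [← inv_eq_of_mul_eq_one_right h']; exact N.inv_mem x.2)
    subst hd
    rw [map_one, mul_one] at h'
    exact Prod.ext (Subtype.ext h') rfl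
  -- `hcard` replaces a proof that N and the dihedral subgroup generate G.
  have hbij : Function.Bijective F := by
    refine hinj.bijective_of_nat_card_le ?_
    rwa [Nat.card_prod, DihedralGroup.nat_card]
  exact ⟨m, ⟨(MulEquiv.ofBijective F hbij).symm.trans (e.prodCongr (MulEquiv.refl _))⟩⟩

/-- The product criterion with trivial N applies; comparing orders removes the factor C₂ᵐ. -/
lemma nonempty_dihedral_three_mulEquiv_S3 : Nonempty (DihedralGroup 3 ≃* S3) := by
  obtain ⟨m, ⟨e⟩⟩ := exists_mulEquiv_C2pow_prod_dihedral (G := S3) (n := 3) ⊥ (by simp)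
    (finRotate 3) (Equiv.swap 0 1) (by decide) (by decide) (by decide) (by simp) (by simp)
    (by simp only [Subgroup.mem_bot]; decide) (by simp only [Subgroup.mem_bot]; decide)
    (by simp [Nat.card_eq_fintype_card, Fintype.card_perm, Nat.factorial])
  have h := Nat.card_congr e.toEquiv
  have hm : Nat.card (C2pow m) = 2 ^ m := by simp [Nat.card_eq_fintype_card]
  rw [Nat.card_prod, hm, DihedralGroup.nat_card, Nat.card_eq_fintype_card, Fintype.card_perm] at h
  have : m = 0 := by
    rcases m with _ | m
    · rfl
    · rw [pow_succ] at h
      have := Nat.one_le_two_pow (n := m)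
      norm_num [Nat.factorial] at h
  subst this
  exact ⟨(e.trans (C2powZeroProd _)).symm⟩

end Structure

/-! ### Groups with |I| ≥ 2|G|/3 -/

section Classification

variable {G : Type*} [Group G] [Finite G]

omit [Finite G] in
lemma inv_eq_self_of_mul_self {x : G} (h : x * x = 1) : x⁻¹ = x := inv_eq_of_mul_eq_one_left h

/-- If `|{x | x ^ 2 = 1}| ≥ 2|G|/3`, then a centralizer of index three of an involution consists
of involutions. -/
lemma mul_self_of_mem_centralizer_of_index_three (hi : 2 * Nat.card G ≤ 3 * (sqOne G).ncard)
    {g : G} (hg : g ∈ sqOne G) (h3 : (Subgroup.centralizer {g}).index = 3) :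
    ∀ a ∈ Subgroup.centralizer {g}, a * a = 1 := by
  intro a ha
  have h1 := two_mul_ncard_sqOne_le hg
  have h2 := (Subgroup.centralizer {g}).card_mul_index
  have h4 : (Subgroup.centralizer {g} : Set G).ncard = Nat.card (Subgroup.centralizer {g}) := rfl
  -- |I ∩ C(g)| ≥ 2|I| - |G| ≥ |G|/3 = |C(g)|.
  have h5 : (sqOne G ∩ Subgroup.centralizer {g} : Set G) = Subgroup.centralizer {g} :=
    Set.eq_of_subset_of_ncard_le Set.inter_subset_right (by rw [h3] at h2; omega)
  have h6 : a ∈ (sqOne G ∩ Subgroup.centralizer {g} : Set G) := h5.symm ▸ ha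
  exact h6.1

/-- In the situation of a centralizer of index three, `g` does not commute with all conjugates. -/
lemma exists_conj_not_commute_of_index_three (hi : 2 * Nat.card G ≤ 3 * (sqOne G).ncard)
    {g : G} (hg : g ∈ sqOne G) (h3 : (Subgroup.centralizer {g}).index = 3) :
    ∃ b : G, b * g * b⁻¹ ∉ Subgroup.centralizer {g} := by
  set A := Subgroup.centralizer {g} with hAdef
  have hA := mul_self_of_mem_centralizer_of_index_three hi hg h3
  have hcomm : ∀ a ∈ A, ∀ c ∈ A, a * c = c * a := fun a ha c hc => by
    have h := inv_eq_self_of_mul_self (hA _ (A.mul_mem ha hc))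
    rw [mul_inv_rev, inv_eq_self_of_mul_self (hA a ha), inv_eq_self_of_mul_self (hA c hc)] at h
    exact h.symm
  by_contra! hall
  -- If all conjugates of g lie in the abelian group A, then A is normal. An involution dies in the
  -- quotient of order 3, so I ⊆ A, contradicting |I| ≥ 2|G|/3.
  have hconj : ∀ b, ∀ a ∈ A, b * a * b⁻¹ ∈ A := fun b a ha => by
    have h := hcomm a ha _ (hall b⁻¹)
    rw [inv_inv] at h
    rw [hAdef, Subgroup.mem_centralizer_singleton_iff]
    calc b * a * b⁻¹ * g = b * (a * (b⁻¹ * g * b)) * b⁻¹ := by group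
      _ = g * (b * a * b⁻¹) := by rw [h]; group
  have hn : A.Normal := ⟨fun a ha b => hconj b a ha⟩
  have hsub : sqOne G ⊆ A := fun b hb => by
    have := A.pow_index_mem b
    rwa [h3, pow_succ, pow_two, mem_sqOne.1 hb, one_mul] at this
  have h1 := ncard_le_card_of_subset hsub
  have h2 := A.card_mul_index
  have h4 : 0 < Nat.card A := Nat.card_pos
  rw [h3] at h2
  omega

set_option linter.unusedSimpArgs false in
-- The three conjugates of g are g, a non-commuting h, and ghg⁻¹. The complement is N = C(g) ∩ C(h),
-- of order at least |G|/6.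
lemma exists_mulEquiv_C2pow_prod_S3 (hi : 2 * Nat.card G ≤ 3 * (sqOne G).ncard)
    {g : G} (hg : g ∈ sqOne G) (h3 : (Subgroup.centralizer {g}).index = 3) :
    ∃ m : ℕ, Nonempty (G ≃* C2pow m × S3) := by
  obtain ⟨b, hb⟩ := exists_conj_not_commute_of_index_three hi hg h3
  have hA := mul_self_of_mem_centralizer_of_index_three hi hg h3
  set A := Subgroup.centralizer {g} with hAdef
  have hmem : ∀ x, x ∈ A ↔ g * x = x * g := fun x => by
    rw [hAdef, Subgroup.mem_centralizer_singleton_iff, eq_comm]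
  have hgg : g * g = 1 := hg
  have hginv := inv_eq_self_of_mul_self hgg
  obtain ⟨h, hh⟩ : ∃ h, h = b * g * b⁻¹ := ⟨_, rfl⟩
  rw [← hh] at hb
  have hhh : h * h = 1 := by
    rw [hh]
    calc b * g * b⁻¹ * (b * g * b⁻¹) = b * (g * g) * b⁻¹ := by group
      _ = 1 := by rw [hgg]; group
  have hhinv := inv_eq_self_of_mul_self hhh
  have hgA : g ∈ A := (hmem g).2 rfl
  have hnc : g * h ≠ h * g := fun e => hb ((hmem h).2 e)
  have hgne : g ≠ h := fun e => hnc (by rw [e])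
  have hgconj : g * h * g⁻¹ ≠ h := fun e => hnc (by rw [mul_inv_eq_iff_eq_mul] at e; exact e)
  have hgconj' : g * h * g⁻¹ ≠ g := fun e => by
    rw [mul_inv_eq_iff_eq_mul, mul_right_inj] at e
    exact hgne e.symm
  have h0 : A.index ≠ 0 := by omega
  have conj1 : (1 : G) * g * 1⁻¹ = g := by group
  have conj2 : g * b * g * (g * b)⁻¹ = g * h * g⁻¹ := by rw [hh]; group
  -- Two of the conjugates g, h, ghg⁻¹, hgh⁻¹ agree; any coincidence but this one makes g and h
  -- equal or commuting.
  have hbraid : g * h * g⁻¹ = h * g * h⁻¹ := by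
    obtain ⟨i, j, hij, e⟩ := exists_conj_eq h0 h3.le ![1, b, g * b, h]
    fin_cases i <;> fin_cases j <;> simp only [Fin.reduceFinMk, Fin.isValue] at hij e <;>
      first
      | exact absurd hij (by decide)
      | (simp only [Fin.zero_eta, Fin.mk_one, Matrix.cons_val, conj1, conj2, ← hh] at e
         first
         | exact e
         | exact absurd e hgne
         | exact absurd e.symm hgconj
         | exact absurd e.symm hgconj'
         | (rw [eq_mul_inv_iff_mul_eq] at e
            first
            | exact absurd e hnc
            | exact absurd (mul_left_cancel e) hgne.symm))
  let N := A ⊓ Subgroup.centralizer {h}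
  have hmemN : ∀ x, x ∈ N ↔ x ∈ A ∧ h * x = x * h := fun x => by
    rw [eq_comm (a := h * x), ← Subgroup.mem_centralizer_singleton_iff]
    exact Subgroup.mem_inf
  have hcardA : Nat.card A ≤ 2 * Nat.card N := by
    refine card_le_two_mul_card (g := g) fun a ha => ?_
    have conj3 : a * b * g * (a * b)⁻¹ = a * h * a⁻¹ := by rw [hh]; group
    have hag : a * h * a⁻¹ ≠ g := fun e => by
      rw [mul_inv_eq_iff_eq_mul, (hmem a).1 ha, mul_right_inj] at e
      exact hgne e.symm
    obtain ⟨i, j, hij, e⟩ := exists_conj_eq h0 h3.le ![1, b, g * b, a * b]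
    -- As a fixes g, it cannot send h to g. In the two remaining cases a, respectively ga,
    -- centralizes h.
    have key : a * h * a⁻¹ = h ∨ a * h * a⁻¹ = g * h * g⁻¹ := by
      fin_cases i <;> fin_cases j <;> simp only [Fin.reduceFinMk, Fin.isValue] at hij e <;>
        first
        | exact absurd hij (by decide)
        | (simp only [Fin.zero_eta, Fin.mk_one, Matrix.cons_val, conj1, conj2, conj3, ← hh] at e
           first
           | exact Or.inl e.symm
           | exact Or.inr e.symm
           | exact absurd e hgne
           | exact absurd e.symm hgconj
           | exact absurd e.symm hgconj'
           | exact absurd e.symm hag)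
    rcases key with e | e
    · left
      rw [mul_inv_eq_iff_eq_mul] at e
      exact (hmemN a).2 ⟨ha, e.symm⟩
    · right
      rw [mul_inv_eq_iff_eq_mul, hginv] at e
      refine (hmemN _).2 ⟨A.mul_mem hgA ha, ?_⟩
      rw [mul_assoc g a h, e]
      simp only [← mul_assoc, hgg, one_mul]
  have hcard : Nat.card G ≤ Nat.card N * (2 * 3) := by
    have := A.card_mul_index
    rw [h3] at this
    omega
  rw [hginv, hhinv] at hbraid
  have ht : (g * h) ^ 3 = 1 := by
    calc (g * h) ^ 3 = g * h * g * (h * g * h) := by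
          simp only [pow_succ, pow_zero, one_mul, mul_assoc]
      _ = h * g * (h * h) * g * h := by rw [hbraid]; simp only [mul_assoc]
      _ = h * (g * g) * h := by rw [hhh]; simp only [mul_assoc, one_mul]
      _ = 1 := by rw [hgg, mul_one, hhh]
  have hst : g * (g * h) * g = (g * h)⁻¹ := by
    rw [mul_inv_rev, hginv, hhinv, ← mul_assoc, hgg, one_mul]
  have ht1 : g * h ∉ A := fun e => hb ((A.mul_mem_cancel_left hgA).1 e)
  have ht2 : (g * h) ^ 2 ∉ A := fun e => ht1 (by
    rw [eq_inv_of_mul_eq_one_left (a := (g * h) ^ 2) (b := g * h) (by rw [← pow_succ, ht])] at e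
    exact A.inv_mem_iff.1 e)
  have hNg : ∀ x ∈ N, Commute x g := fun x hx => ((hmem x).1 ((hmemN x).1 hx).1).symm
  have hNh : ∀ x ∈ N, Commute x h := fun x hx => (((hmemN x).1 hx).2).symm
  obtain ⟨m, ⟨e⟩⟩ := exists_mulEquiv_C2pow_prod_dihedral N
    (fun x hx => hA x ((hmemN x).1 hx).1) (g * h) g ht hgg hst
    (fun x hx => (hNg x hx).mul_right (hNh x hx)) hNg
    (fun k hk hkN => by
      have hkA := ((hmemN _).1 hkN).1
      interval_cases k
      · rfl
      · rw [pow_one] at hkA; exact absurd hkA ht1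
      · exact absurd hkA ht2)
    (fun k hk hkN => by
      have hkA := (A.mul_mem_cancel_left hgA).1 ((hmemN _).1 hkN).1
      interval_cases k
      · rw [pow_zero, mul_one] at hkN
        exact hnc ((hmemN _).1 hkN).2.symm
      · rw [pow_one] at hkA; exact ht1 hkA
      · exact ht2 hkA) hcard
  obtain ⟨f⟩ := nonempty_dihedral_three_mulEquiv_S3
  exact ⟨m, ⟨e.trans ((MulEquiv.refl _).prodCongr f)⟩⟩

/-- In a group of exponent two a nontrivial element is avoided by a subgroup of index two. -/
lemma exists_subgroup_not_mem (Z : Subgroup G) (hZ : ∀ x ∈ Z, x * x = 1) {z : G} (hz : z ∈ Z)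
    (hz1 : z ≠ 1) : ∃ M ≤ Z, z ∉ M ∧ Nat.card Z ≤ 2 * Nat.card M := by
  obtain ⟨n, ⟨e⟩⟩ := exists_mulEquiv_C2pow Z (fun x => Subtype.ext (hZ x x.2))
  -- M is the kernel of a coordinate that is nontrivial on z.
  obtain ⟨i, hi⟩ : ∃ i, e ⟨z, hz⟩ i ≠ 1 := by
    by_contra! h
    refine hz1 (congrArg Subtype.val (?_ : (⟨z, hz⟩ : Z) = 1))
    rw [← e.map_eq_one_iff]
    exact funext h
  let φ : Z →* Multiplicative (ZMod 2) := (Pi.evalMonoidHom _ i).comp e.toMonoidHom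
  have hφ : ∀ (x : G) (hx : x ∈ Z), x ∈ φ.ker.map Z.subtype ↔ φ ⟨x, hx⟩ = 1 := by
    intro x hx
    constructor
    · rintro ⟨y, hy, rfl⟩
      exact hy
    · exact fun h => ⟨⟨x, hx⟩, h, rfl⟩
  refine ⟨φ.ker.map Z.subtype, Subgroup.map_subtype_le _, fun h => hi ((hφ z hz).1 h),
    card_le_two_mul_card (g := z) fun a ha => ?_⟩
  rw [hφ a ha, hφ (z * a) (Z.mul_mem hz ha)]
  have hmul : φ ⟨z * a, Z.mul_mem hz ha⟩ = φ ⟨z, hz⟩ * φ ⟨a, ha⟩ := φ.map_mul ⟨z, hz⟩ ⟨a, ha⟩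
  rw [hmul]
  exact (by decide : ∀ x y : Multiplicative (ZMod 2), x ≠ 1 → y = 1 ∨ x * y = 1) _ _ hi

/-- With C = C(g) and |G| = 2|C|, one has |I \ C| ≤ |C|/2 and |I| ≥ 4|C|/3. Hence |I ∩ C| ≥ 5|C|/6,
beyond the three-quarters threshold. -/
lemma mul_self_of_mem_centralizer_of_index_two (hi : 2 * Nat.card G ≤ 3 * (sqOne G).ncard)
    {g : G} (hg : g ∈ sqOne G) (h2 : (Subgroup.centralizer {g}).index = 2) :
    ∀ a ∈ Subgroup.centralizer {g}, a * a = 1 := by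
  intro a ha
  set C := Subgroup.centralizer {g} with hC
  have h1 := two_mul_ncard_sqOne_diff_le hg
  have h3 := Set.ncard_inter_add_ncard_sdiff_eq_ncard (sqOne G) (C : Set G)
  have h4 := C.card_mul_index
  have h5 : 0 < Nat.card C := Nat.card_pos
  have h6 := ncard_sqOne_subgroup C
  rw [← hC] at h1
  rw [h2] at h4
  have := mul_self_of_three_mul_card_lt (G := C) (by omega) ⟨a, ha⟩
  exact congrArg Subtype.val this

/-- For an involution w outside C(g), the rotation t = wg has order 4. The index bound is needed for
w as well as for g. -/
lemma exists_mulEquiv_C2pow_prod_D8 (hi : 2 * Nat.card G ≤ 3 * (sqOne G).ncard)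
    (hle : ∀ g ∈ sqOne G, (Subgroup.centralizer {g}).index ≤ 2)
    {g : G} (hg : g ∈ sqOne G) (hne : Subgroup.centralizer {g} ≠ ⊤) :
    ∃ m : ℕ, Nonempty (G ≃* C2pow m × D8) := by
  have index_two : ∀ x ∈ sqOne G, Subgroup.centralizer {x} ≠ ⊤ →
      (Subgroup.centralizer {x}).index = 2 := fun x hx hx' => by
    have h1 := hle x hx
    have h2 : (Subgroup.centralizer {x}).index ≠ 0 := Subgroup.FiniteIndex.index_ne_zero
    have h3 : (Subgroup.centralizer {x}).index ≠ 1 := fun h => hx' (Subgroup.index_eq_one.1 h)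
    omega
  have h2 := index_two g hg hne
  have hCexp := mul_self_of_mem_centralizer_of_index_two hi hg h2
  set C := Subgroup.centralizer {g} with hC
  have hmem : ∀ x, x ∈ C ↔ g * x = x * g := fun x => by
    rw [hC, Subgroup.mem_centralizer_singleton_iff, eq_comm]
  obtain ⟨w, hw, hwC⟩ : ∃ w ∈ sqOne G, w ∉ C := by
    by_contra! h
    exact hne (Subgroup.eq_top_of_sqOne_subset h (by
      have : 0 < Nat.card G := Nat.card_pos
      omega))
  have hgg : g * g = 1 := hg
  have hww : w * w = 1 := hw
  have hginv := inv_eq_self_of_mul_self hgg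
  have hwinv := inv_eq_self_of_mul_self hww
  have hgC : g ∈ C := (hmem g).2 rfl
  have hgw : g * w ≠ w * g := fun e => hwC ((hmem w).2 e)
  have hgCw : g ∉ Subgroup.centralizer {w} := fun e =>
    hgw (Subgroup.mem_centralizer_singleton_iff.1 e)
  have h2w := index_two w hw (fun e => hgCw (e ▸ Subgroup.mem_top g))
  let Z := C ⊓ Subgroup.centralizer {w}
  have hmemZ : ∀ x, x ∈ Z ↔ x ∈ C ∧ w * x = x * w := fun x => by
    rw [eq_comm (a := w * x), ← Subgroup.mem_centralizer_singleton_iff]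
    exact Subgroup.mem_inf
  -- C(w) has index 2 and misses g, so it contains a or ga.
  have hcardC : Nat.card C ≤ 2 * Nat.card Z := by
    refine card_le_two_mul_card (g := g) fun a ha => ?_
    by_cases haw : a ∈ Subgroup.centralizer {w}
    · exact Or.inl ⟨ha, haw⟩
    · refine Or.inr ⟨C.mul_mem hgC ha, (Subgroup.mul_mem_iff_of_index_two h2w).2 ?_⟩
      exact iff_of_false hgCw haw
  have hconj : w * g * w ∈ C := by
    have := (Subgroup.normal_of_index_eq_two h2).conj_mem g hgC w
    rwa [hwinv] at this
  have htt : (w * g) ^ 2 = w * g * w * g := by rw [pow_two, ← mul_assoc]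
  have hzC : (w * g) ^ 2 ∈ C := htt ▸ C.mul_mem hconj hgC
  have hzz := hCexp _ hzC
  have ht : (w * g) ^ 4 = 1 := by rw [← hzz, ← pow_add]
  have htinv : (w * g)⁻¹ = g * w := by rw [mul_inv_rev, hginv, hwinv]
  have hzZ : (w * g) ^ 2 ∈ Z := by
    refine (hmemZ _).2 ⟨hzC, ?_⟩
    have h : (w * g) ^ 2 = (g * w) ^ 2 := by
      rw [← htinv, inv_pow, inv_eq_self_of_mul_self hzz]
    calc w * (w * g) ^ 2 = w * w * (g * w * g) := by rw [htt]; simp only [mul_assoc]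
      _ = g * w * g * (w * w) := by rw [hww, one_mul, mul_one]
      _ = (w * g) ^ 2 * w := by rw [h, pow_two]; simp only [mul_assoc]
  have hz1 : (w * g) ^ 2 ≠ 1 := fun e => by
    rw [pow_two] at e
    exact hgw (htinv ▸ inv_eq_of_mul_eq_one_left e)
  -- Z meets the dihedral group in t², so the complement must be a subgroup of index 2 in Z avoiding
  -- t².
  obtain ⟨M, hMZ, hzM, hcardM⟩ := exists_subgroup_not_mem Z
    (fun x hx => hCexp x ((hmemZ x).1 hx).1) hzZ hz1
  have hMC : ∀ x ∈ M, x ∈ C := fun x hx => ((hmemZ x).1 (hMZ hx)).1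
  have hMg : ∀ x ∈ M, Commute x g := fun x hx => ((hmem x).1 (hMC x hx)).symm
  have hMw : ∀ x ∈ M, Commute x w := fun x hx => (((hmemZ x).1 (hMZ hx)).2).symm
  have ht1 : w * g ∉ C := fun e => hwC ((C.mul_mem_cancel_right hgC).1 e)
  have ht3 : (w * g) ^ 3 ∉ C := fun e => ht1 (by
    rw [pow_succ] at e
    exact (C.mul_mem_cancel_left hzC).1 e)
  refine exists_mulEquiv_C2pow_prod_dihedral M (fun x hx => hCexp x (hMC x hx)) (w * g) g ht hgg
    (by rw [htinv, mul_assoc, mul_assoc, hgg, mul_one])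
    (fun x hx => (hMw x hx).mul_right (hMg x hx)) hMg ?_ ?_ ?_
  · intro k hk hkM
    have hkC := hMC _ hkM
    interval_cases k
    · rfl
    · rw [pow_one] at hkC; exact absurd hkC ht1
    · exact absurd hkM hzM
    · exact absurd hkC ht3
  · intro k hk hkM
    have hkC := (C.mul_mem_cancel_left hgC).1 (hMC _ hkM)
    have hkw := (hMZ hkM).2
    interval_cases k
    · rw [pow_zero, mul_one] at hkw; exact hgCw hkw
    · rw [pow_one] at hkC; exact ht1 hkC
    · exact hgCw ((Subgroup.mul_mem_cancel_right _ hzZ.2).1 hkw)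
    · exact ht3 hkC
  -- |G| = 2|C| ≤ 4|Z| ≤ 8|M|.
  · have := C.card_mul_index
    rw [h2] at this
    omega

/-- Groups in which at least two thirds of the elements satisfy `x ^ 2 = 1`. -/
lemma classification_of_two_mul_card_le (hi : 2 * Nat.card G ≤ 3 * (sqOne G).ncard) :
    (∃ n : ℕ, Nonempty (G ≃* C2pow n × S3)) ∨ (∃ n : ℕ, Nonempty (G ≃* C2pow n × D8)) ∨
      ∃ n : ℕ, Nonempty (G ≃* C2pow n) := by
  have hpos : 0 < Nat.card G := Nat.card_pos
  by_cases hcomm : ∀ g ∈ sqOne G, Subgroup.centralizer {g} = ⊤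
  · have hZ : Subgroup.center G = ⊤ := Subgroup.eq_top_of_sqOne_subset (fun g hg =>
      Subgroup.mem_center_iff.2 fun y =>
        Subgroup.mem_centralizer_singleton_iff.1 (hcomm g hg ▸ Subgroup.mem_top y)) (by omega)
    exact Or.inr (Or.inr (exists_mulEquiv_C2pow G (mul_self_of_commute
      (fun x y => Subgroup.mem_center_iff.1 (hZ ▸ Subgroup.mem_top y) x) (by omega))))
  · push Not at hcomm
    obtain ⟨g, hg, hne⟩ := hcomm
    -- |C(g)| ≥ 2|I| - |G| ≥ |G|/3.
    have hle3 : ∀ g ∈ sqOne G, (Subgroup.centralizer {g}).index ≤ 3 := fun g hg => by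
      have h1 := two_mul_ncard_sqOne_le hg
      have h2 := ncard_le_card_of_subset
        (S := sqOne G ∩ Subgroup.centralizer {g}) (H := Subgroup.centralizer {g})
        Set.inter_subset_right
      have h3 := (Subgroup.centralizer {g}).card_mul_index
      by_contra! h4
      nlinarith
    by_cases hle : ∀ g ∈ sqOne G, (Subgroup.centralizer {g}).index ≤ 2
    · exact Or.inr (Or.inl (exists_mulEquiv_C2pow_prod_D8 hi hle hg hne))
    · push Not at hle
      obtain ⟨x, hx, hx2⟩ := hle
      exact Or.inl (exists_mulEquiv_C2pow_prod_S3 hi hx (le_antisymm (hle3 x hx) hx2))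

end Classification

/-! ### Commutativity and nilpotency of the three families -/

section Nilpotency

/-- The quotient S₃ has trivial center. -/
lemma not_isNilpotent_C2pow_prod_S3 (n : ℕ) : ¬ Group.IsNilpotent (C2pow n × S3) := by
  intro h
  have h1 : Group.IsNilpotent S3 :=
    Group.nilpotent_of_surjective (MonoidHom.snd (C2pow n) S3) Prod.snd_surjective
  refine Group.IsNilpotent.center_ne_bot (G := S3) ((Subgroup.eq_bot_iff_forall _).2 ?_)
  intro x hx
  rw [Subgroup.mem_center_iff] at hx
  exact (by decide : ∀ x : S3, (∀ y, y * x = x * y) → x = 1) x hx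

lemma isNilpotent_C2pow_prod_D8 (n : ℕ) : Group.IsNilpotent (C2pow n × D8) := by
  have h : IsPGroup 2 D8 := IsPGroup.of_card (n := 3) (by rw [DihedralGroup.nat_card]; norm_num)
  have : Group.IsNilpotent D8 := h.isNilpotent
  infer_instance

lemma not_commute_C2pow_prod_D8 (n : ℕ) : ¬ ∀ x y : C2pow n × D8, x * y = y * x := fun h =>
  absurd (congrArg Prod.snd (h (1, .r 1) (1, .sr 0)))
    (by decide : ¬ (.r 1 * .sr 0 : D8) = .sr 0 * .r 1)

lemma commute_congr {G H : Type*} [Group G] [Group H] (e : G ≃* H) :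
    (∀ x y : G, x * y = y * x) ↔ ∀ x y : H, x * y = y * x := by
  constructor
  · intro h x y
    apply e.symm.injective
    rw [map_mul, map_mul, h]
  · intro h x y
    apply e.injective
    rw [map_mul, map_mul, h]

lemma isNilpotent_congr {G H : Type*} [Group G] [Group H] (e : G ≃* H) :
    Group.IsNilpotent G ↔ Group.IsNilpotent H :=
  ⟨fun _ => Group.nilpotent_of_surjective e.toMonoidHom e.surjective,
    fun _ => Group.nilpotent_of_surjective e.symm.toMonoidHom e.symm.surjective⟩

end Nilpotency

/-! ### The classification in terms of α, and the maxima -/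

lemma classification_of_alpha_ge (G : Type u) [Group G] [Finite G] (h : alpha G ≥ 5 / 6) :
    ((∃ n : ℕ, Nonempty (G ≃* C2pow n × S3)) ∧ alpha G = 5 / 6) ∨
    ((∃ n : ℕ, Nonempty (G ≃* C2pow n × D8)) ∧ alpha G = 7 / 8) ∨
    ((∃ n : ℕ, Nonempty (G ≃* C2pow n)) ∧ alpha G = 1) := by
  rcases classification_of_two_mul_card_le (two_mul_card_le_of_alpha h) with
    ⟨n, ⟨e⟩⟩ | ⟨n, ⟨e⟩⟩ | ⟨n, ⟨e⟩⟩
  · exact Or.inl ⟨⟨n, ⟨e⟩⟩, by rw [alpha_congr e, alpha_C2pow_prod_S3]⟩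
  · exact Or.inr (Or.inl ⟨⟨n, ⟨e⟩⟩, by rw [alpha_congr e, alpha_C2pow_prod_D8]⟩)
  · exact Or.inr (Or.inr ⟨⟨n, ⟨e⟩⟩, by rw [alpha_congr e, alpha_C2pow]⟩)

/-- The maximum of `α` on a family and its maximizers, from a description of the members of large
`α`. -/
lemma isMaxAlpha_and_maximizers {F : Set FiniteGrp.{u}} {a : ℚ} {K : ℕ → Type} [∀ n, Group (K n)]
    [∀ n, Finite (K n)] (hα : ∀ n, alpha (K n) = a)
    (hF : ∀ (G : FiniteGrp.{u}) (n : ℕ), Nonempty (G ≃* K n) → G ∈ F)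
    (hmax : ∀ G ∈ F, alpha G ≥ a → ∃ n, Nonempty (G ≃* K n)) :
    IsMaxAlpha F a ∧ maximizers F = {G : FiniteGrp.{u} | ∃ n : ℕ, Nonempty (G ≃* K n)} := by
  have hgreatest : IsMaxAlpha F a := by
    constructor
    -- The model groups live in `Type`; lifting gives a member of F in universe `u`.
    · let G : FiniteGrp.{u} := FiniteGrp.of (ULift.{u} (K 0))
      have e : G ≃* K 0 := MulEquiv.ulift
      exact ⟨G, hF G 0 ⟨e⟩, by rw [alpha_congr e, hα]⟩
    · rintro _ ⟨G, hG, rfl⟩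
      by_contra! h
      obtain ⟨n, ⟨e⟩⟩ := hmax G hG h.le
      rw [alpha_congr e, hα] at h
      exact lt_irrefl _ h
  refine ⟨hgreatest, Set.ext fun G => ⟨fun hG => ?_, ?_⟩⟩
  · exact hmax G hG.1 (hG.2.unique hgreatest).ge
  · rintro ⟨n, ⟨e⟩⟩
    refine ⟨hF G n ⟨e⟩, ?_⟩
    rwa [alpha_congr e, hα]

theorem mainTheorem5 :
    -- the values of `α` on the groups that occur
    (alpha S3 = 5 / 6 ∧ alpha D8 = 7 / 8 ∧
      ∀ n : ℕ, alpha (C2pow n × S3) = 5 / 6 ∧ alpha (C2pow n × D8) = 7 / 8 ∧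
        alpha (C2pow n) = 1) ∧
    -- the classification
    (∀ (G : Type u) [Group G] [Finite G], alpha G ≥ 5 / 6 →
      ((∃ n : ℕ, Nonempty (G ≃* C2pow n × S3)) ∧ alpha G = 5 / 6) ∨
      ((∃ n : ℕ, Nonempty (G ≃* C2pow n × D8)) ∧ alpha G = 7 / 8) ∨
      ((∃ n : ℕ, Nonempty (G ≃* C2pow n)) ∧ alpha G = 1)) ∧
    -- the maximum over non-abelian groups
    (IsMaxAlpha nonAbelianGroups.{u} (7 / 8) ∧
      maximizers nonAbelianGroups.{u} =
        {G : FiniteGrp.{u} | ∃ n : ℕ, Nonempty (G ≃* C2pow n × D8)}) ∧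
    -- the maximum over non-nilpotent groups
    (IsMaxAlpha nonNilpotentGroups.{u} (5 / 6) ∧
      maximizers nonNilpotentGroups.{u} =
        {G : FiniteGrp.{u} | ∃ n : ℕ, Nonempty (G ≃* C2pow n × S3)}) := by
  refine ⟨⟨?_, ?_, fun n => ⟨alpha_C2pow_prod_S3 n, alpha_C2pow_prod_D8 n, alpha_C2pow n⟩⟩,
    classification_of_alpha_ge, ?_, ?_⟩
  · rw [← alpha_congr (C2powZeroProd S3), alpha_C2pow_prod_S3]
  · rw [← alpha_congr (C2powZeroProd D8), alpha_C2pow_prod_D8]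
  · refine isMaxAlpha_and_maximizers alpha_C2pow_prod_D8 (fun G n ⟨e⟩ => ?_) fun G hG h => ?_
    · exact fun hc => not_commute_C2pow_prod_D8 n ((commute_congr e).1 hc)
    · rcases classification_of_alpha_ge G (le_trans (by norm_num) h) with
        ⟨-, h'⟩ | ⟨h', -⟩ | ⟨⟨n, ⟨e⟩⟩, -⟩
      -- The S₃ family is excluded by 5/6 < 7/8.
      · rw [h'] at h
        norm_num at h
      · exact h'
      · exact absurd ((commute_congr e).2 mul_comm) hG
  · refine isMaxAlpha_and_maximizers alpha_C2pow_prod_S3 (fun G n ⟨e⟩ => ?_) fun G hG h => ?_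
    · exact fun hc => not_isNilpotent_C2pow_prod_S3 n ((isNilpotent_congr e).1 hc)
    · rcases classification_of_alpha_ge G h with ⟨h', -⟩ | ⟨⟨n, ⟨e⟩⟩, -⟩ | ⟨⟨n, ⟨e⟩⟩, -⟩
      · exact h'
      · exact absurd ((isNilpotent_congr e).2 (isNilpotent_C2pow_prod_D8 n)) hG
      · exact absurd ((isNilpotent_congr e).2 inferInstance) hG
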